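/- Let $T$ be a set. A \emph{simple max-stable process} on $T$ is a real-valued process $X=\{X_t\}_{t\in T}$ with $P(X_t\le x)=e^{-1/x}$ for $x>0$ and such that, for every $n\ge 1$, the pointwise maximum of $n$ independent copies of $X$ has the same law as $nX$. Its \emph{extremal coefficient function} (ECF) is given by $\theta(\emptyset)=0$ and, for nonempty finite $A\subset T$ and $t\in A$, $$\theta(A)=\lim_{x\to\infty}\frac{\log P(\max_{s\in A}X_s\le x)}{\log P(X_t\le x)}.$$ For nonempty finite $M\subset T$, let $\ell_M(x)=-\log P(X_t\le 1/x_t,\ t\in M)$ for $x\in[0,\infty)^M$ (with $1/0=\infty$), and let $\mathcal K_M$ be the largest compact convex set in $[0,\infty)^M$ such that $\ell_M(x)=\sup\{\sum_{t\in M}x_ty_t : y\in\mathcal K_M\}$ for all $x\in[0,\infty)^M$. The \emph{dependency set} of $X$ is $$\mathcal K=\{y\in[0,\infty)^T : (y_t)_{t\in M}\in\mathcal K_M\text{ for all nonempty finite }M\subset T\}.$$ Let $\theta$ be a real function on the finite subsets of $T$ which is negative definite, i.e. $\sum_{j,k=1}^n a_ja_k\,\theta(K_j\cup K_k)\le 0$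 for all $n\ge2$, all finite $K_1,\dots,K_n\subset T$ and all real $a_1,\dots,a_n$ with $\sum_j a_j=0$, and which satisfies $\theta(\emptyset)=0$ and $\theta(\{t\})=1$ for all $t\in T$. Let $X^*$ be the \emph{Tawn--Molchanov (TM) process} with ECF $\theta$, i.e. the simple max-stable process with $$-\log P(X^*_t\le x_t,\ t\in M)=\sum_{\emptyset\ne L\subset M}\tau^M_L\max_{t\in L}\frac1{x_t},\qquad \tau^M_L=\sum_{I\subset L}(-1)^{|I|+1}\theta\bigl((M\setminus L)\cup I\bigr),$$ for all nonempty finite $M\subset T$ and $x\in(0,\infty)^M$. Then $X^*$ has ECF $\theta$, and its dependency set $\mathcal K^*$ exists and is $$\mathcal K^*=\bigcap_{\emptyset\ne A\subset T,\ A\text{ finite}}\Bigl\{x\in[0,\infty)^T : \sum_{t\in A}x_t\le\theta(A)\Bigr\}.$$ In particular, $\mathcal K^*$ contains the dependency set of every simple max-stable process on $T$ that has the same ECF $\theta$. -/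

import Mathlib

open MeasureTheory Filter Topology

noncomputable section

/-- `X = (X t)_{t ∈ T}` is a *simple max-stable process* on the probability space `(Ω, P)`: all
`X t` are (measurable) random variables with standard Fréchet distribution, and for every `n ≥ 1`
the pointwise maximum of `n` independent copies of `X` has the same law as `n X`. The independent
copies are the processes `ω ↦ X t (ω i)`, `i : Fin n`, on the product probability space `Ω ^ n`,
and the laws are measures on `T → ℝ` with the product σ-algebra. -/
structure IsSimpleMaxStable {T Ω : Type*} [MeasurableSpace Ω] (P : Measure Ω)
    (X : T → Ω → ℝ) : Prop where
  measurable : ∀ t, Measurable (X t)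
  frechet : ∀ t, ∀ x : ℝ, 0 < x → P.real {ω | X t ω ≤ x} = Real.exp (-1 / x)
  max_stable : ∀ n : ℕ, 1 ≤ n →
    (Measure.pi fun _ : Fin n => P).map (fun ω t => ⨆ i : Fin n, X t (ω i)) =
      P.map (fun ω t => (n : ℝ) * X t ω)

/-- `θ` is the *extremal coefficient function* (ECF) of the process `X`: `θ ∅ = 0`, and for finite
nonempty `A` (and any `t ∈ A`)
`θ A = lim_{x → ∞} log P(max_{s ∈ A} X s ≤ x) / log P(X t ≤ x)`. -/
def HasECF {T Ω : Type*} [MeasurableSpace Ω] (P : Measure Ω) (X : T → Ω → ℝ)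
    (θ : Finset T → ℝ) : Prop :=
  θ ∅ = 0 ∧ ∀ A : Finset T, ∀ t ∈ A,
    Tendsto (fun x : ℝ =>
        Real.log (P.real {ω | ∀ s ∈ A, X s ω ≤ x}) / Real.log (P.real {ω | X t ω ≤ x}))
      atTop (𝓝 (θ A))

/-- The *stable tail dependence function* `ℓ_M(x) = - log P(X t ≤ 1 / x t, t ∈ M)` on `[0, ∞)^M`,
where `1 / 0 = ∞`, so that there is no constraint on `X t` if `x t = 0`. -/
def stableTail {T Ω : Type*} [MeasurableSpace Ω] (P : Measure Ω) (X : T → Ω → ℝ)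
    (M : Finset T) (x : M → ℝ) : ℝ :=
  -Real.log (P.real {ω | ∀ t : M, 0 < x t → X t ω ≤ 1 / x t})

/-- `K` is the *finite dimensional dependency set* of `(X t)_{t ∈ M}`: the largest compact convex
subset of `[0, ∞)^M` with `ℓ_M(x) = sup {⟨x, y⟩ | y ∈ K}` for all `x ∈ [0, ∞)^M`. -/
def IsFinDependencySet {T Ω : Type*} [MeasurableSpace Ω] (P : Measure Ω) (X : T → Ω → ℝ)
    (M : Finset T) (K : Set (M → ℝ)) : Prop :=
  IsGreatest {C : Set (M → ℝ) | IsCompact C ∧ Convex ℝ C ∧ (∀ y ∈ C, ∀ t, 0 ≤ y t) ∧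
    ∀ x : M → ℝ, (∀ t, 0 ≤ x t) →
      IsLUB ((fun y : M → ℝ => ∑ t, x t * y t) '' C) (stableTail P X M x)} K

/-- `D ⊆ [0, ∞)^T` is the *dependency set* of the process `X`: the intersection, over all
nonempty finite `M`, of the preimages of the dependency sets of `(X t)_{t ∈ M}` under the
projections `[0, ∞)^T → [0, ∞)^M`. -/
def IsDependencySet {T Ω : Type*} [MeasurableSpace Ω] (P : Measure Ω) (X : T → Ω → ℝ)
    (D : Set (T → ℝ)) : Prop :=
  ∃ K : (M : Finset T) → Set (M → ℝ),
    (∀ M : Finset T, M.Nonempty → IsFinDependencySet P X M (K M)) ∧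
    D = {y | (∀ t, 0 ≤ y t) ∧ ∀ M : Finset T, M.Nonempty → (fun t : M => y t) ∈ K M}

/-- The halfspace `{x ∈ [0, ∞)^T | ∑_{t ∈ A} x t ≤ θ A}`. -/
def halfspace {T : Type*} (θ : Finset T → ℝ) (A : Finset T) : Set (T → ℝ) :=
  {x | (∀ t, 0 ≤ x t) ∧ ∑ t ∈ A, x t ≤ θ A}

/-- Negative definiteness, in the semigroup sense, on the finite subsets of `T` with union. -/
def IsNegDefOnFinsets {T : Type*} [DecidableEq T] (ψ : Finset T → ℝ) : Prop :=
  ∀ n : ℕ, 2 ≤ n → ∀ (K : Fin n → Finset T) (a : Fin n → ℝ), ∑ j, a j = 0 →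
    ∑ j, ∑ k, a j * a k * ψ (K j ∪ K k) ≤ 0

/-- The coefficients `τ^M_L = ∑_{I ⊆ L} (-1)^(|I| + 1) θ((M \ L) ∪ I)`. -/
def tmCoeff {T : Type*} [DecidableEq T] (θ : Finset T → ℝ) (M L : Finset T) : ℝ :=
  ∑ I ∈ L.powerset, (-1) ^ (I.card + 1) * θ ((M \ L) ∪ I)

/-- `X` is the *Tawn–Molchanov process* associated with `θ`, where `θ` is negative definite with
`θ ∅ = 0` and `θ {t} = 1`: the simple max-stable process with finite dimensional distributions
`- log P(X t ≤ x t, t ∈ M) = ∑_{∅ ≠ L ⊆ M} τ^M_L max_{t ∈ L} 1 / x t`. -/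
structure IsTMProcess {T Ω : Type*} [DecidableEq T] [MeasurableSpace Ω] (P : Measure Ω)
    (X : T → Ω → ℝ) (θ : Finset T → ℝ) : Prop where
  negDef : IsNegDefOnFinsets θ
  empty : θ ∅ = 0
  singleton : ∀ t, θ {t} = 1
  simple : IsSimpleMaxStable P X
  fdd : ∀ M : Finset T, M.Nonempty → ∀ x : T → ℝ, (∀ t ∈ M, 0 < x t) →
    P.real {ω | ∀ t ∈ M, X t ω ≤ x t} =
      Real.exp (-∑ L ∈ M.powerset with L.Nonempty, tmCoeff θ M L * ⨆ t : L, 1 / x t)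

end

/-! For fixed `M`, negative definiteness makes the coefficients τ^M_L nonnegative, and
inclusion–exclusion identifies θ(B), for B ⊆ M, with the total τ^M-weight of the sets L meeting B.
So θ is a coverage function on subsets of `M`, and the tail dependence function of the TM process is
the corresponding Choquet integral. Its support set is the core polytope `coreOn θ M`: peeling off
level sets gives the upper bound (`sum_mul_le_sum_mul_iSup`), and giving each weight τ_L to a
maximizer of x on L attains it (`exists_sum_mul_eq_sum_mul_iSup`).

Conversely, for any simple max-stable process with ECF θ, max-stability makes the tail dependence
function equal to θ(A) at the indicator of A, so every set it supports satisfies the core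
inequalities (`sum_indicator_mul_le_ecf`). This gives both the maximality of the core and the
comparison with other processes. -/

section TMCoeff

/-! ### Möbius inversion and positivity of the TM coefficients. -/

variable {T : Type*} [DecidableEq T]

/-- Toggling a point of `I` in `J` flips the sign but leaves `I ∪ J` unchanged, so the terms cancel
in pairs. -/
lemma sum_powerset_neg_one_pow_union_eq_zero (f : Finset T → ℝ) {L I : Finset T} (hI : I ⊆ L)
    (hne : I.Nonempty) : ∑ J ∈ L.powerset, (-1 : ℝ) ^ J.card * f (I ∪ J) = 0 := by
  obtain ⟨i, hi⟩ := hne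
  have hL : insert i (L.erase i) = L := Finset.insert_erase (hI hi)
  rw [← hL, Finset.sum_powerset_insert (Finset.notMem_erase i L), ← Finset.sum_add_distrib]
  refine Finset.sum_eq_zero fun J hJ => ?_
  have hiJ : i ∉ J := fun h => Finset.notMem_erase i L (Finset.mem_powerset.1 hJ h)
  have hU : I ∪ insert i J = I ∪ J := by
    rw [Finset.union_insert, Finset.insert_eq_of_mem (Finset.mem_union_left _ hi)]
  rw [hU, Finset.card_insert_of_notMem hiJ]
  ring

lemma sum_powerset_neg_one_pow_union (f : Finset T → ℝ) (L : Finset T) :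
    ∑ I ∈ L.powerset, ∑ J ∈ L.powerset, (-1 : ℝ) ^ I.card * (-1) ^ J.card * f (I ∪ J) =
      ∑ J ∈ L.powerset, (-1 : ℝ) ^ J.card * f J := by
  rw [Finset.sum_eq_single_of_mem ∅ (Finset.empty_mem_powerset L)]
  · simp
  · intro I hI hne
    simp only [mul_assoc, ← Finset.mul_sum]
    rw [sum_powerset_neg_one_pow_union_eq_zero f (Finset.mem_powerset.1 hI)
      (Finset.nonempty_iff_ne_empty.2 hne), mul_zero]

/-- Negative definiteness for families indexed by an arbitrary finset. -/
lemma IsNegDefOnFinsets.sum_le {θ : Finset T → ℝ} (h : IsNegDefOnFinsets θ) {ι : Type*}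
    (s : Finset ι) (hs : 2 ≤ s.card) (K : ι → Finset T) (a : ι → ℝ) (ha : ∑ j ∈ s, a j = 0) :
    ∑ j ∈ s, ∑ k ∈ s, a j * a k * θ (K j ∪ K k) ≤ 0 := by
  have key : ∀ g : ι → ℝ, ∑ j : Fin s.card, g (s.equivFin.symm j) = ∑ j ∈ s, g j := fun g => by
    rw [Equiv.sum_comp s.equivFin.symm fun j : s => g j, Finset.sum_coe_sort]
  have := h s.card hs (fun j => K (s.equivFin.symm j)) (fun j => a (s.equivFin.symm j))
    ((key a).trans ha)
  rw [← key]
  simp_rw [← key]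
  exact this

/-- Negative definiteness is tested on the sets `(M \ L) ∪ I` with coefficients `(-1) ^ I.card`; the
quadratic form collapses to minus the TM coefficient. Nonemptiness of `L` makes the coefficients sum
to zero. -/
lemma tmCoeff_nonneg {θ : Finset T → ℝ} (h : IsNegDefOnFinsets θ) (M : Finset T) {L : Finset T}
    (hL : L.Nonempty) : 0 ≤ tmCoeff θ M L := by
  have hcard : 2 ≤ L.powerset.card := by
    rw [Finset.card_powerset]
    calc 2 = 2 ^ 1 := rfl
      _ ≤ 2 ^ L.card := Nat.pow_le_pow_right two_pos hL.card_pos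
  have hsum : ∑ I ∈ L.powerset, (-1 : ℝ) ^ I.card = 0 := by
    have := Finset.sum_powerset_neg_one_pow_card_of_nonempty hL
    exact_mod_cast this
  have := h.sum_le L.powerset hcard (fun I => (M \ L) ∪ I) (fun I => (-1) ^ I.card) hsum
  simp_rw [← Finset.union_union_distrib_left] at this
  rw [sum_powerset_neg_one_pow_union fun S => θ ((M \ L) ∪ S)] at this
  simp only [tmCoeff, pow_succ, mul_neg, mul_one, neg_mul, Finset.sum_neg_distrib]
  linarith

/-- Reindexing by `S = L \ I` turns the argument of `θ` into `M \ S`; the alternating sum over `I`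
then vanishes unless `S = M \ B`. -/
lemma sum_tmCoeff_powerset_sdiff (θ : Finset T → ℝ) {M B : Finset T} (hB : B ⊆ M) :
    ∑ L ∈ (M \ B).powerset, tmCoeff θ M L = -θ B := by
  have swap : ∑ L ∈ (M \ B).powerset, tmCoeff θ M L =
      ∑ S ∈ (M \ B).powerset, ∑ I ∈ ((M \ B) \ S).powerset,
        (-1 : ℝ) ^ (I.card + 1) * θ (M \ S) := by
    simp only [tmCoeff]
    rw [Finset.sum_sigma', Finset.sum_sigma']
    refine Finset.sum_bij' (fun p _ => ⟨p.1 \ p.2, p.2⟩) (fun p _ => ⟨p.1 ∪ p.2, p.2⟩)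
      ?_ ?_ ?_ ?_ ?_
    · rintro ⟨L, I⟩ h
      simp only [Finset.mem_sigma, Finset.mem_powerset] at h ⊢
      exact ⟨Finset.sdiff_subset.trans h.1, by grind⟩
    · rintro ⟨S, I⟩ h
      simp only [Finset.mem_sigma, Finset.mem_powerset] at h ⊢
      exact ⟨by grind, Finset.subset_union_right⟩
    · rintro ⟨L, I⟩ h
      simp only [Finset.mem_sigma, Finset.mem_powerset] at h
      simp [Finset.sdiff_union_of_subset h.2]
    · rintro ⟨S, I⟩ h
      simp only [Finset.mem_sigma, Finset.mem_powerset] at h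
      have : (S ∪ I) \ I = S := by grind
      simp [this]
    · rintro ⟨L, I⟩ h
      simp only [Finset.mem_sigma, Finset.mem_powerset] at h
      have : M \ L ∪ I = M \ (L \ I) := by grind
      simp [this]
  rw [swap, Finset.sum_eq_single_of_mem (M \ B) (Finset.mem_powerset_self _)]
  · simp [Finset.inter_eq_right.2 hB]
  · intro S hS hne
    have hne' : ((M \ B) \ S).Nonempty := by
      rw [Finset.sdiff_nonempty]
      exact fun h => hne (Finset.Subset.antisymm (Finset.mem_powerset.1 hS) h)
    have : ∑ I ∈ ((M \ B) \ S).powerset, (-1 : ℝ) ^ I.card = 0 := by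
      exact_mod_cast Finset.sum_powerset_neg_one_pow_card_of_nonempty hne'
    rw [← Finset.sum_mul]
    simp only [pow_succ, ← Finset.sum_mul, this, zero_mul]

/-- The sum over all `L ⊆ M` is `-θ ∅ = 0`, so the sets meeting `B` must balance those missing it.
-/
lemma sum_tmCoeff_inter_nonempty {θ : Finset T → ℝ} (h0 : θ ∅ = 0) {M B : Finset T}
    (hB : B ⊆ M) : ∑ L ∈ M.powerset with (L ∩ B).Nonempty, tmCoeff θ M L = θ B := by
  have h1 := sum_tmCoeff_powerset_sdiff θ hB
  have h2 := sum_tmCoeff_powerset_sdiff θ (Finset.empty_subset M)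
  rw [Finset.sdiff_empty, h0, neg_zero,
    ← Finset.sum_filter_add_sum_filter_not _ fun L => (L ∩ B).Nonempty] at h2
  have h3 : (M.powerset.filter fun L => ¬(L ∩ B).Nonempty) = (M \ B).powerset := by
    ext L
    simp only [Finset.mem_filter, Finset.mem_powerset, Finset.subset_sdiff,
      Finset.not_nonempty_iff_eq_empty, Finset.disjoint_iff_inter_eq_empty]
  rw [h3, h1] at h2
  linarith

lemma sum_tmCoeff_nonempty {θ : Finset T → ℝ} (h0 : θ ∅ = 0) (M : Finset T) :
    ∑ L ∈ M.powerset with L.Nonempty, tmCoeff θ M L = θ M := by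
  rw [← sum_tmCoeff_inter_nonempty h0 (Finset.Subset.refl M)]
  refine Finset.sum_congr (Finset.filter_congr fun L hL => ?_) fun _ _ => rfl
  rw [Finset.inter_eq_left.2 (Finset.mem_powerset.1 hL)]

lemma IsNegDefOnFinsets.mono {θ : Finset T → ℝ} (h : IsNegDefOnFinsets θ) (h0 : θ ∅ = 0)
    {A B : Finset T} (hAB : A ⊆ B) : θ A ≤ θ B := by
  rw [← sum_tmCoeff_inter_nonempty h0 hAB, ← sum_tmCoeff_nonempty h0 B]
  refine Finset.sum_le_sum_of_subset_of_nonneg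
    (Finset.monotone_filter_right _ fun L _ hL => hL.mono Finset.inter_subset_left) ?_
  exact fun L hL _ => tmCoeff_nonneg h B (Finset.mem_filter.1 hL).2

end TMCoeff

/-! ### The Choquet integral as support function of a core. -/

section SupportFunction

lemma le_iSup_finset {T : Type*} (x : T → ℝ) {L : Finset T} {t : T} (ht : t ∈ L) : x t ≤ ⨆ s : L, x s :=
  le_ciSup (f := fun s : L => x s) (Set.finite_range _).bddAbove ⟨t, ht⟩

variable {T : Type*} [DecidableEq T]

/-- The Choquet integral of `x` with respect to the coverage function with weights `w` dominates
`∑ x t * y t` if the coverage function dominates the measure `y`. -/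
lemma sum_mul_le_sum_mul_iSup (M : Finset T) (w : Finset T → ℝ)
    (hw : ∀ L ∈ M.powerset, L.Nonempty → 0 ≤ w L) (y : T → ℝ)
    (hy : ∀ A ⊆ M, A.Nonempty → ∑ t ∈ A, y t ≤ ∑ L ∈ M.powerset with (L ∩ A).Nonempty, w L)
    (x : T → ℝ) (hx : ∀ t ∈ M, 0 ≤ x t) :
    ∑ t ∈ M, x t * y t ≤ ∑ L ∈ M.powerset with L.Nonempty, w L * ⨆ t : L, x t := by
  -- The induction is on the size of the support of `x`: subtracting the least positive value on the
  -- support removes at least one point from it.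
  induction hn : (M.filter fun t => 0 < x t).card using Nat.strong_induction_on generalizing x with
  | _ n ih =>
  set S := M.filter fun t => 0 < x t with hS
  rcases S.eq_empty_or_nonempty with h | h
  · have hx0 : ∀ t ∈ M, x t = 0 := fun t ht => by
      refine le_antisymm (not_lt.1 fun hlt => ?_) (hx t ht)
      exact Finset.notMem_empty t (h ▸ Finset.mem_filter.2 ⟨ht, hlt⟩)
    rw [Finset.sum_eq_zero fun t ht => by rw [hx0 t ht, zero_mul]]
    refine Finset.sum_nonneg fun L hL => ?_
    rw [Finset.mem_filter] at hL
    exact mul_nonneg (hw L hL.1 hL.2)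
      (Real.iSup_nonneg fun t => hx t (Finset.mem_powerset.1 hL.1 t.2))
  · obtain ⟨t₀, ht₀, hmin⟩ := S.exists_min_image x h
    have hm : 0 < x t₀ := (Finset.mem_filter.1 ht₀).2
    set x' : T → ℝ := fun t => if t ∈ S then x t - x t₀ else x t with hx'
    have hx'0 : ∀ t ∈ M, 0 ≤ x' t := fun t ht => by
      simp only [hx']
      split_ifs with h
      · exact sub_nonneg.2 (hmin t h)
      · exact hx t ht
    have hlt : (M.filter fun t => 0 < x' t).card < n := by
      rw [← hn]
      refine Finset.card_lt_card ((Finset.ssubset_iff_of_subset fun t ht => ?_).2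
        ⟨t₀, ht₀, by simp [hx', ht₀]⟩)
      rw [Finset.mem_filter] at ht
      by_contra htS
      have h2 := ht.2
      simp only [hx', htS, if_false] at h2
      exact htS (Finset.mem_filter.2 ⟨ht.1, h2⟩)
    have key := ih _ hlt x' hx'0 rfl
    have hsplit : ∑ t ∈ M, x t * y t = x t₀ * ∑ t ∈ S, y t + ∑ t ∈ M, x' t * y t := by
      rw [hS, Finset.sum_filter, Finset.mul_sum, ← Finset.sum_add_distrib]
      refine Finset.sum_congr rfl fun t ht => ?_
      have : t ∈ S ↔ 0 < x t := by simp [hS, ht]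
      simp only [hx', this]
      split_ifs <;> ring
    have hS' := mul_le_mul_of_nonneg_left (hy S (Finset.filter_subset _ _) h) hm.le
    have hfil : ∑ L ∈ M.powerset with (L ∩ S).Nonempty, w L =
        ∑ L ∈ M.powerset with L.Nonempty, if (L ∩ S).Nonempty then w L else 0 := by
      rw [← Finset.sum_filter, Finset.filter_filter]
      refine Finset.sum_congr (Finset.filter_congr fun L _ => ?_) fun _ _ => rfl
      exact ⟨fun h => ⟨h.mono Finset.inter_subset_left, h⟩, fun h => h.2⟩
    rw [hfil] at hS'
    rw [hsplit]
    refine (add_le_add hS' key).trans ?_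
    rw [Finset.mul_sum, ← Finset.sum_add_distrib]
    refine Finset.sum_le_sum fun L hL => ?_
    rw [Finset.mem_filter, Finset.mem_powerset] at hL
    have hwL := hw L (Finset.mem_powerset.2 hL.1) hL.2
    have : Nonempty L := hL.2.to_subtype
    split_ifs with hLS
    -- If `L` meets `S`, its supremum drops by at least `x t₀`, which pays for the layer peeled off.
    · rw [mul_comm, ← mul_add]
      refine mul_le_mul_of_nonneg_left ?_ hwL
      rw [← le_sub_iff_add_le']
      refine ciSup_le fun t => ?_
      simp only [hx']
      split_ifs with htS
      · exact sub_le_sub_right (le_iSup_finset x t.2) _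
      · obtain ⟨s, hs⟩ := hLS
        rw [Finset.mem_inter] at hs
        have h1 : x t ≤ 0 := not_lt.1 fun h =>
          htS (Finset.mem_filter.2 ⟨hL.1 t.2, h⟩)
        have h2 := hmin s hs.2
        have h3 := le_iSup_finset x hs.1
        linarith
    · rw [mul_zero, zero_add]
      refine mul_le_mul_of_nonneg_left (ciSup_le fun t => ?_) hwL
      have htS : (t : T) ∉ S := fun h => hLS ⟨t, Finset.mem_inter.2 ⟨t.2, h⟩⟩
      simp only [hx', htS, if_false]
      exact le_iSup_finset x t.2

/-- The bound of `sum_mul_le_sum_mul_iSup` is attained, by giving the weight of each set to one of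
its points where `x` is maximal. -/
lemma exists_sum_mul_eq_sum_mul_iSup (M : Finset T) (w : Finset T → ℝ)
    (hw : ∀ L ∈ M.powerset, L.Nonempty → 0 ≤ w L) (x : T → ℝ) :
    ∃ y : T → ℝ, (∀ t, 0 ≤ y t) ∧ (∀ t ∉ M, y t = 0) ∧
      (∀ A, ∑ t ∈ A, y t ≤ ∑ L ∈ M.powerset with (L ∩ A).Nonempty, w L) ∧
      ∑ t ∈ M, x t * y t = ∑ L ∈ M.powerset with L.Nonempty, w L * ⨆ t : L, x t := by
  -- The value `none` serves the empty set, so that `T` need not be inhabited.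
  have hmax : ∀ L : Finset T, ∃ t : Option T, L.Nonempty →
      ∃ s ∈ L, t = some s ∧ ∀ r ∈ L, x r ≤ x s := fun L => by
    by_cases hL : L.Nonempty
    · obtain ⟨s, hs, h⟩ := L.exists_max_image x hL
      exact ⟨some s, fun _ => ⟨s, hs, rfl, h⟩⟩
    · exact ⟨none, fun h => absurd h hL⟩
  choose c hc using hmax
  have hw' : ∀ L ∈ M.powerset.filter fun L => L.Nonempty, 0 ≤ w L := fun L hL =>
    hw L (Finset.mem_filter.1 hL).1 (Finset.mem_filter.1 hL).2
  refine ⟨fun t => ∑ L ∈ M.powerset with L.Nonempty, if c L = some t then w L else 0,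
    fun t => Finset.sum_nonneg fun L hL => ?_, fun t ht => Finset.sum_eq_zero fun L hL => ?_,
    fun A => ?_, ?_⟩
  · split_ifs
    exacts [hw' L hL, le_rfl]
  · rw [Finset.mem_filter, Finset.mem_powerset] at hL
    obtain ⟨s, hs, hcs, -⟩ := hc L hL.2
    rw [hcs, if_neg]
    rintro ⟨⟩
    exact ht (hL.1 hs)
  · have hfil : ∑ L ∈ M.powerset with (L ∩ A).Nonempty, w L =
        ∑ L ∈ M.powerset with L.Nonempty, if (L ∩ A).Nonempty then w L else 0 := by
      rw [← Finset.sum_filter, Finset.filter_filter]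
      refine Finset.sum_congr (Finset.filter_congr fun L _ => ?_) fun _ _ => rfl
      exact ⟨fun h => ⟨h.mono Finset.inter_subset_left, h⟩, fun h => h.2⟩
    rw [Finset.sum_comm, hfil]
    refine Finset.sum_le_sum fun L hL => ?_
    have hwL := hw' L hL
    obtain ⟨s, hs, hcs, -⟩ := hc L (Finset.mem_filter.1 hL).2
    simp only [hcs, Option.some.injEq, Finset.sum_ite_eq]
    by_cases hsA : s ∈ A
    · rw [if_pos hsA, if_pos ⟨s, Finset.mem_inter.2 ⟨hs, hsA⟩⟩]
    · rw [if_neg hsA]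
      split_ifs
      exacts [hwL, le_rfl]
  · simp only [Finset.mul_sum]
    rw [Finset.sum_comm]
    refine Finset.sum_congr rfl fun L hL => ?_
    rw [Finset.mem_filter, Finset.mem_powerset] at hL
    obtain ⟨s, hs, hcs, hle⟩ := hc L hL.2
    have : Nonempty L := hL.2.to_subtype
    have hsup : ⨆ t : L, x t = x s :=
      le_antisymm (ciSup_le fun t => hle t t.2) (le_iSup_finset x hs)
    simp only [hcs, Option.some.injEq, mul_ite, mul_zero, Finset.sum_ite_eq, if_pos (hL.1 hs),
      hsup, mul_comm]

end SupportFunction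

/-! ### Homogeneity from max-stability. -/

section MaxStable

variable {T Ω : Type*} [MeasurableSpace Ω] {P : Measure Ω} {X : T → Ω → ℝ}

/-- Both laws in `max_stable` are evaluated on the box `f ≤ n` over `A`: independence gives the
power, and `n * X ≤ n` means `X ≤ 1`. -/
lemma IsSimpleMaxStable.real_forall_le_pow [IsProbabilityMeasure P] (h : IsSimpleMaxStable P X)
    (A : Finset T) {n : ℕ} (hn : 1 ≤ n) :
    P.real {ω | ∀ s ∈ A, X s ω ≤ n} ^ n = P.real {ω | ∀ s ∈ A, X s ω ≤ 1} := by
  have hn0 : (0 : ℝ) < n := by exact_mod_cast hn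
  have : Nonempty (Fin n) := ⟨⟨0, hn⟩⟩
  have hB : MeasurableSet {f : T → ℝ | ∀ s ∈ A, f s ≤ n} := by
    have : {f : T → ℝ | ∀ s ∈ A, f s ≤ n} = ⋂ s ∈ A, {f : T → ℝ | f s ≤ n} := by ext; simp
    rw [this]
    exact A.measurableSet_biInter fun s _ =>
      measurableSet_le (measurable_pi_apply s) measurable_const
  have hm := congrArg (fun μ => μ {f : T → ℝ | ∀ s ∈ A, f s ≤ n}) (h.max_stable n hn)
  have hX := h.measurable
  have hmax : Measurable fun (ω : Fin n → Ω) t => ⨆ i : Fin n, X t (ω i) :=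
    measurable_pi_lambda _ fun t => Measurable.iSup fun i => (hX t).comp (measurable_pi_apply i)
  have hmul : Measurable fun ω t => (n : ℝ) * X t ω :=
    measurable_pi_lambda _ fun t => (hX t).const_mul _
  rw [Measure.map_apply hmax hB, Measure.map_apply hmul hB] at hm
  have h1 : (fun (ω : Fin n → Ω) t => ⨆ i : Fin n, X t (ω i)) ⁻¹'
      {f : T → ℝ | ∀ s ∈ A, f s ≤ n} =
      Set.pi Set.univ fun _ => {ω | ∀ s ∈ A, X s ω ≤ n} := by
    ext ω
    simp only [Set.mem_preimage, Set.mem_ofPred_eq, Set.mem_pi, Set.mem_univ, true_implies]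
    have : ∀ s, ⨆ i : Fin n, X s (ω i) ≤ n ↔ ∀ i, X s (ω i) ≤ n := fun s =>
      ciSup_le_iff (Set.finite_range _).bddAbove
    simp only [this]
    exact ⟨fun h i s hs => h s hs i, fun h s hs i => h i s hs⟩
  have h2 : (fun ω t => (n : ℝ) * X t ω) ⁻¹' {f : T → ℝ | ∀ s ∈ A, f s ≤ n} =
      {ω | ∀ s ∈ A, X s ω ≤ 1} := by
    ext ω
    simp only [Set.mem_preimage, Set.mem_ofPred_eq]
    refine forall₂_congr fun s _ => ?_
    rw [mul_le_iff_le_one_right hn0]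
  rw [h1, h2, Measure.pi_pi] at hm
  simp only [Finset.prod_const, Finset.card_univ, Fintype.card_fin] at hm
  rw [Measure.real, Measure.real, ← ENNReal.toReal_pow, hm]

/-- The extremal coefficients of a simple max-stable process are the exponents of the law of its
maxima at `1`. -/
lemma IsSimpleMaxStable.ecf_eq [IsProbabilityMeasure P] (h : IsSimpleMaxStable P X)
    {θ : Finset T → ℝ} (hθ : HasECF P X θ) {A : Finset T} (hA : A.Nonempty) :
    -Real.log (P.real {ω | ∀ s ∈ A, X s ω ≤ 1}) = θ A := by
  obtain ⟨t, ht⟩ := hA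
  -- Along the integers the quotient defining the ECF is constant: numerator and denominator both
  -- scale like `1 / n`.
  have hlim := (hθ.2 A t ht).comp tendsto_natCast_atTop_atTop
  refine tendsto_nhds_unique (tendsto_const_nhds.congr' ?_) hlim
  filter_upwards [eventually_ge_atTop 1] with n hn
  have hn0 : (0 : ℝ) < n := by exact_mod_cast hn
  simp only [Function.comp]
  rw [h.frechet t n hn0, Real.log_exp, ← h.real_forall_le_pow A hn, Real.log_pow]
  field_simp

end MaxStable

/-! ### Dependency sets of TM processes. -/

section TMProcess

variable {T Ω : Type*} [DecidableEq T] [MeasurableSpace Ω] {P : Measure Ω} {X : T → Ω → ℝ}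
  {θ : Finset T → ℝ}

lemma IsTMProcess.hasECF [IsProbabilityMeasure P] (h : IsTMProcess P X θ) : HasECF P X θ := by
  refine ⟨h.empty, fun A t ht => tendsto_const_nhds.congr' ?_⟩
  filter_upwards [eventually_gt_atTop 0] with x hx
  have hA : ∑ L ∈ A.powerset with L.Nonempty, tmCoeff θ A L * ⨆ _ : L, 1 / x = θ A * (1 / x) := by
    rw [← sum_tmCoeff_nonempty h.empty A, Finset.sum_mul]
    refine Finset.sum_congr rfl fun L hL => ?_
    have : Nonempty L := (Finset.mem_filter.1 hL).2.to_subtype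
    rw [ciSup_const]
  rw [h.simple.frechet t x hx, h.fdd A ⟨t, ht⟩ (fun _ => x) fun _ _ => hx, Real.log_exp,
    Real.log_exp, hA]
  field_simp

lemma stableTail_indicator_eq [IsProbabilityMeasure P] (h : IsSimpleMaxStable P X)
    (hθ : HasECF P X θ) {M A : Finset T} (hAM : A ⊆ M) (hA : A.Nonempty) :
    stableTail P X M (fun t => if (t : T) ∈ A then 1 else 0) = θ A := by
  rw [← h.ecf_eq hθ hA, stableTail]
  congr 4
  ext ω
  simp only [Subtype.forall]
  refine ⟨fun H s hs => ?_, fun H s _ hpos => ?_⟩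
  · simpa [hs] using H s (hAM hs)
  · have hs : s ∈ A := by
      by_contra hs
      simp [hs] at hpos
    simpa [hs] using H s hs

/-- Coordinates with `x t ≤ 0` impose no constraint, so the distribution formula is applied on the
positive support, with the coefficients of that smaller set. -/
lemma IsTMProcess.stableTail_eq [IsProbabilityMeasure P] (h : IsTMProcess P X θ) (M : Finset T)
    (x : T → ℝ) :
    stableTail P X M (fun t => x t) =
      ∑ L ∈ (M.filter fun t => 0 < x t).powerset with L.Nonempty,
        tmCoeff θ (M.filter fun t => 0 < x t) L * ⨆ t : L, x t := by
  set S := M.filter fun t => 0 < x t with hS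
  have hset : {ω | ∀ t : M, 0 < x t → X t ω ≤ 1 / x t} = {ω | ∀ t ∈ S, X t ω ≤ 1 / x t} := by
    ext ω
    simp [hS]
  rw [stableTail, hset]
  rcases S.eq_empty_or_nonempty with h0 | h0
  · rw [h0]
    simp [Finset.filter_singleton]
  · rw [h.fdd S h0 (fun t => 1 / x t) fun t ht => one_div_pos.2 (Finset.mem_filter.1 ht).2,
      Real.log_exp, neg_neg]
    simp only [one_div_one_div]

/-- The polytope cut out of `[0, ∞)^M` by the halfspaces of the subsets of `M`. -/
def coreOn (θ : Finset T → ℝ) (M : Finset T) : Set (M → ℝ) :=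
  {y | (∀ t, 0 ≤ y t) ∧ ∀ A ⊆ M, A.Nonempty → ∑ t : M, (if (t : T) ∈ A then 1 else 0) * y t ≤ θ A}

lemma sum_indicator_mul_coe {M A : Finset T} (hA : A ⊆ M) (y : T → ℝ) :
    ∑ t : M, (if (t : T) ∈ A then 1 else 0) * y t = ∑ t ∈ A, y t := by
  rw [Finset.sum_coe_sort M fun t => (if t ∈ A then 1 else 0) * y t]
  simp only [ite_mul, one_mul, zero_mul, ← Finset.sum_filter]
  rw [Finset.filter_mem_eq_inter, Finset.inter_eq_right.2 hA]

lemma isCompact_coreOn (h1 : ∀ t, θ {t} = 1) (M : Finset T) : IsCompact (coreOn θ M) := by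
  refine (isCompact_univ_pi fun _ : M => isCompact_Icc (a := (0 : ℝ)) (b := 1)).of_isClosed_subset
    ?_ fun y hy t _ => ⟨hy.1 t, ?_⟩
  · simp only [coreOn, Set.ofPred_and, Set.ofPred_forall]
    refine IsClosed.inter (isClosed_iInter fun t => isClosed_le (by fun_prop) (by fun_prop))
      (isClosed_iInter fun A => isClosed_iInter fun _ => isClosed_iInter fun _ =>
        isClosed_le (by fun_prop) (by fun_prop))
  -- The singleton constraints confine the polytope to the unit cube.
  · have := hy.2 {(t : T)} (Finset.singleton_subset_iff.2 t.2) (Finset.singleton_nonempty _)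
    simpa [h1, ← Subtype.ext_iff] using this

lemma convex_coreOn (M : Finset T) : Convex ℝ (coreOn θ M) := by
  intro y hy z hz a b ha hb hab
  refine ⟨fun t => add_nonneg (mul_nonneg ha (hy.1 t)) (mul_nonneg hb (hz.1 t)), fun A hA hne => ?_⟩
  have h1 := mul_le_mul_of_nonneg_left (hy.2 A hA hne) ha
  have h2 := mul_le_mul_of_nonneg_left (hz.2 A hA hne) hb
  calc _ = a * ∑ t : M, (if (t : T) ∈ A then 1 else 0) * y t +
        b * ∑ t : M, (if (t : T) ∈ A then 1 else 0) * z t := by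
        rw [Finset.mul_sum, Finset.mul_sum, ← Finset.sum_add_distrib]
        refine Finset.sum_congr rfl fun t _ => ?_
        simp only [Pi.add_apply, Pi.smul_apply, smul_eq_mul]
        ring
    _ ≤ a * θ A + b * θ A := add_le_add h1 h2
    _ = θ A := by rw [← add_mul, hab, one_mul]

lemma IsTMProcess.isLUB_coreOn [IsProbabilityMeasure P] (h : IsTMProcess P X θ) (M : Finset T)
    (x : T → ℝ) (hx : ∀ t ∈ M, 0 ≤ x t) :
    IsLUB ((fun y : M → ℝ => ∑ t : M, x t * y t) '' coreOn θ M)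
      (stableTail P X M fun t => x t) := by
  rw [h.stableTail_eq]
  set S := M.filter fun t => 0 < x t with hS
  have hSM : S ⊆ M := Finset.filter_subset _ _
  have hw : ∀ L ∈ S.powerset, L.Nonempty → 0 ≤ tmCoeff θ S L :=
    fun L _ hL => tmCoeff_nonneg h.negDef S hL
  have hsum : ∀ y : T → ℝ, ∑ t : M, x t * y t = ∑ t ∈ S, x t * y t := fun y => by
    rw [Finset.sum_coe_sort M fun t => x t * y t]
    refine (Finset.sum_subset hSM fun t ht htS => ?_).symm
    have : x t ≤ 0 := not_lt.1 fun hlt => htS (Finset.mem_filter.2 ⟨ht, hlt⟩)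
    rw [le_antisymm this (hx t ht), zero_mul]
  refine IsGreatest.isLUB ⟨?_, ?_⟩
  · obtain ⟨y, hy0, hyS, hyA, hyx⟩ := exists_sum_mul_eq_sum_mul_iSup S (tmCoeff θ S) hw x
    refine ⟨fun t => y t, ⟨fun t => hy0 t, fun A hA _ => ?_⟩, (hsum y).trans hyx⟩
    rw [sum_indicator_mul_coe hA]
    -- The maximizer vanishes off `S`, so its constraint on `A` follows from the one on `A ∩ S` by
    -- monotonicity of `θ`.
    have hAS : ∑ t ∈ A, y t = ∑ t ∈ A ∩ S, y t :=
      (Finset.sum_subset Finset.inter_subset_left fun t ht htS =>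
        hyS t fun h => htS (Finset.mem_inter.2 ⟨ht, h⟩)).symm
    rw [hAS]
    refine (hyA _).trans ?_
    rw [sum_tmCoeff_inter_nonempty h.empty Finset.inter_subset_right]
    exact h.negDef.mono h.empty Finset.inter_subset_left
  · rintro _ ⟨y, hy, rfl⟩
    obtain ⟨z, rfl⟩ : ∃ z : T → ℝ, (fun t : M => z t) = y :=
      ⟨fun t => if ht : t ∈ M then y ⟨t, ht⟩ else 0, by ext t; simp⟩
    simp only
    rw [hsum z]
    refine sum_mul_le_sum_mul_iSup S _ hw z (fun A hA hne => ?_) x fun t ht => hx t (hSM ht)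
    rw [sum_tmCoeff_inter_nonempty h.empty hA, ← sum_indicator_mul_coe (hA.trans hSM) z]
    exact hy.2 A (hA.trans hSM) hne

/-- The support function is tested at the indicator of `A`, where it equals `θ A`; nothing specific
to TM processes enters. -/
lemma sum_indicator_mul_le_ecf [IsProbabilityMeasure P]
    (h : IsSimpleMaxStable P X) (hθ : HasECF P X θ) {M A : Finset T} (hAM : A ⊆ M)
    (hA : A.Nonempty) {C : Set (M → ℝ)}
    (hC : ∀ x : M → ℝ, (∀ t, 0 ≤ x t) →
      IsLUB ((fun y : M → ℝ => ∑ t, x t * y t) '' C) (stableTail P X M x))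
    {y : M → ℝ} (hy : y ∈ C) : ∑ t : M, (if (t : T) ∈ A then 1 else 0) * y t ≤ θ A := by
  rw [← stableTail_indicator_eq h hθ hAM hA]
  exact (hC _ fun t => by split_ifs <;> norm_num).1 ⟨y, hy, rfl⟩

lemma IsTMProcess.isFinDependencySet_coreOn [IsProbabilityMeasure P] (h : IsTMProcess P X θ)
    (M : Finset T) : IsFinDependencySet P X M (coreOn θ M) := by
  refine ⟨⟨isCompact_coreOn h.singleton M, convex_coreOn M, fun y hy => hy.1, fun x hx => ?_⟩, ?_⟩
  · obtain ⟨z, rfl⟩ : ∃ z : T → ℝ, (fun t : M => z t) = x :=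
      ⟨fun t => if ht : t ∈ M then x ⟨t, ht⟩ else 0, by ext t; simp⟩
    exact h.isLUB_coreOn M z fun t ht => hx ⟨t, ht⟩
  · rintro C ⟨-, -, hC0, hC⟩ y hy
    exact ⟨hC0 y hy, fun A hA hne =>
      sum_indicator_mul_le_ecf h.simple h.hasECF hA hne hC hy⟩

lemma setOf_forall_mem_coreOn (θ : Finset T → ℝ) :
    {y : T → ℝ | (∀ t, 0 ≤ y t) ∧ ∀ M : Finset T, M.Nonempty → (fun t : M => y t) ∈ coreOn θ M} =
      ⋂ (A : Finset T) (_ : A.Nonempty), halfspace θ A := by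
  ext y
  simp only [Set.mem_ofPred_eq, Set.mem_iInter, halfspace]
  refine ⟨fun hy A hA => ⟨hy.1, ?_⟩, fun hy => ⟨fun t => (hy {t} (by simp)).1 t,
    fun M _ => ⟨fun t => (hy {(t : T)} (by simp)).1 t, fun A hA hne => ?_⟩⟩⟩
  · rw [← sum_indicator_mul_coe (Finset.Subset.refl A)]
    exact (hy.2 A hA).2 A (Finset.Subset.refl A) hA
  · rw [sum_indicator_mul_coe hA]
    exact (hy A hne).2

lemma IsTMProcess.isDependencySet_iff [IsProbabilityMeasure P] (h : IsTMProcess P X θ)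
    (D : Set (T → ℝ)) :
    IsDependencySet P X D ↔ D = ⋂ (A : Finset T) (_ : A.Nonempty), halfspace θ A := by
  rw [← setOf_forall_mem_coreOn]
  constructor
  · rintro ⟨K, hK, rfl⟩
    ext y
    refine and_congr_right fun _ => forall₂_congr fun M hM => ?_
    -- A greatest element is unique, so any admissible family agrees with the cores on nonempty `M`.
    rw [(hK M hM).unique (h.isFinDependencySet_coreOn M)]
  · exact fun hD => ⟨coreOn θ, fun M _ => h.isFinDependencySet_coreOn M, hD⟩

lemma IsDependencySet.subset_iInter_halfspace [IsProbabilityMeasure P]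
    (h : IsSimpleMaxStable P X) (hθ : HasECF P X θ) {D : Set (T → ℝ)}
    (hD : IsDependencySet P X D) : D ⊆ ⋂ (A : Finset T) (_ : A.Nonempty), halfspace θ A := by
  obtain ⟨K, hK, rfl⟩ := hD
  refine fun y hy => Set.mem_iInter₂.2 fun A hA => ⟨hy.1, ?_⟩
  rw [← sum_indicator_mul_coe (Finset.Subset.refl A)]
  exact sum_indicator_mul_le_ecf h hθ (Finset.Subset.refl A) hA
    (hK A hA).1.2.2.2 (hy.2 A hA)

end TMProcess

theorem theorem3 {T : Type*} [DecidableEq T] {Ω : Type*} [MeasurableSpace Ω]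
    (P : Measure Ω) [IsProbabilityMeasure P] (X : T → Ω → ℝ) (θ : Finset T → ℝ)
    (hX : IsTMProcess P X θ) :
    HasECF P X θ ∧
    (∀ D : Set (T → ℝ), IsDependencySet P X D ↔
      D = ⋂ (A : Finset T) (_ : A.Nonempty), halfspace θ A) ∧
    (∀ D : Set (T → ℝ), IsDependencySet P X D →
      ∀ (Ω' : Type*) [MeasurableSpace Ω'] (P' : Measure Ω') [IsProbabilityMeasure P']
        (Y : T → Ω' → ℝ) (D' : Set (T → ℝ)),
        IsSimpleMaxStable P' Y → HasECF P' Y θ → IsDependencySet P' Y D' → D' ⊆ D) := by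
  refine ⟨hX.hasECF, hX.isDependencySet_iff, fun D hD Ω' _ P' _ Y D' hY hθ hD' => ?_⟩
  rw [(hX.isDependencySet_iff D).1 hD]
  exact IsDependencySet.subset_iInter_halfspace hY hθ hD'
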